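/- Let $U\subset\mathbb R^n$ be open and convex and let $f:U\to\mathbb R$ be convex. A sequence $(x_k)_{k\ge 0}$ in $U$ is called a \emph{BFGS sequence} for $f$ if $f$ is differentiable at every $x_k$ with $\nabla f(x_k)\neq 0$, and there exist $0<\mu<\nu<1$ and a (symmetric) positive definite $n\times n$ matrix $H_0$ such that, with $s_k=x_{k+1}-x_k$, $y_k=\nabla f(x_{k+1})-\nabla f(x_k)$ and $$V_k=I-\frac{s_ky_k^T}{s_k^Ty_k},\qquad H_{k+1}=V_kH_kV_k^T+\frac{s_ks_k^T}{s_k^Ty_k},$$ one has for all $k=0,1,2,\ldots$ $$H_k\nabla f(x_k)\in-\mathbb R_+s_k,\qquad f(x_{k+1})\le f(x_k)+\mu\,\nabla f(x_k)^Ts_k,\qquad \nabla f(x_{k+1})^Ts_k\ge\nu\,\nabla f(x_k)^Ts_k .$$ Let $(x_k)$ be a BFGS sequence in $U$ for $f$, and assume that the level set $\{x\in U: f(x)\le f(x_0)\}$ is compact (so that $f$ attains its minimum $\min f$ on $U$). Assume further that $f$ is twice differentiable, with $\nabla^2 f$ positive definite and continuous, throughout the set $\{x\in U: f(x)>\min f\}$.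 Then $f(x_k)\to\min f$ as $k\to\infty$. -/

import Mathlib

/-!
Write `g = ∇f(x_k)`, and let `B_k = H_k⁻¹`. Both terms of the potential `tr B - log det B` change
in a computable way under the BFGS update, and since `B_k s_k` is a multiple of `g`, one step
increases the potential by at most
`‖y‖² / ⟪s, y⟫ - 1 - log (‖g‖² ⟪s, y⟫ / ⟪g, s⟫²)`.
The potential is bounded below. If `‖y‖² ≤ M ⟪s, y⟫` along the sequence, then the argument of the
logarithm cannot tend to infinity. The Armijo condition forces `⟪g, s⟫ → 0`, and the curvature
condition gives `⟪s, y⟫ ≥ (1 - ν) |⟪g, s⟫|`, so the gradients cannot stay away from zero (Powell).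

If `f(x_k)` stayed above some `c > min f`, the iterates would remain in a compact subset of
`{f > min f}`. There the gradient map satisfies `‖y‖² ≤ M ⟪s, y⟫`: near the diagonal because the
Hessian is continuous and positive definite, and away from it because `∇f` is strictly monotone,
even though the segment between two points may leave the region. Small gradients at bounded points
force `f(x_k)` close to `min f` by convexity, a contradiction.
-/

open Filter Topology

/-- The BFGS update of the inverse Hessian approximation `H` for a step `s` and a gradient
difference `y`: with `V = I - s yᵀ / (sᵀ y)`, it is `V H Vᵀ + s sᵀ / (sᵀ y)`. -/
noncomputable def bfgsUpdate {n : ℕ} (H : Matrix (Fin n) (Fin n) ℝ)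
    (s y : EuclideanSpace ℝ (Fin n)) : Matrix (Fin n) (Fin n) ℝ :=
  (1 - (inner ℝ s y)⁻¹ • Matrix.vecMulVec s.ofLp y.ofLp) * H *
      (1 - (inner ℝ s y)⁻¹ • Matrix.vecMulVec s.ofLp y.ofLp).transpose +
    (inner ℝ s y)⁻¹ • Matrix.vecMulVec s.ofLp s.ofLp

/-- The matrices `H₀, H₁, H₂, …` generated recursively by the BFGS update, with
`s_k = x_{k+1} - x_k` and `y_k = ∇f(x_{k+1}) - ∇f(x_k)`. -/
noncomputable def bfgsMatrix {n : ℕ} (f : EuclideanSpace ℝ (Fin n) → ℝ)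
    (x : ℕ → EuclideanSpace ℝ (Fin n)) (H₀ : Matrix (Fin n) (Fin n) ℝ) :
    ℕ → Matrix (Fin n) (Fin n) ℝ
  | 0 => H₀
  | k + 1 => bfgsUpdate (bfgsMatrix f x H₀ k) (x (k + 1) - x k)
      (gradient f (x (k + 1)) - gradient f (x k))

/-- `x` is a BFGS sequence for `f`. (In the theorem the iterates lie in an open set `U`, so the
conditions only depend on the values of `f` on `U`.) -/
def IsBFGSSequence {n : ℕ} (f : EuclideanSpace ℝ (Fin n) → ℝ)
    (x : ℕ → EuclideanSpace ℝ (Fin n)) : Prop :=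
  (∀ k, DifferentiableAt ℝ f (x k) ∧ gradient f (x k) ≠ 0) ∧
  ∃ (μ ν : ℝ) (H₀ : Matrix (Fin n) (Fin n) ℝ),
    0 < μ ∧ μ < ν ∧ ν < 1 ∧ H₀.PosDef ∧
    ∀ k,
      (∃ c : ℝ, 0 ≤ c ∧
        (bfgsMatrix f x H₀ k).mulVec (gradient f (x k)).ofLp = -(c • (x (k + 1) - x k).ofLp)) ∧
      f (x (k + 1)) ≤ f (x k) + μ * inner ℝ (gradient f (x k)) (x (k + 1) - x k) ∧
      ν * inner ℝ (gradient f (x k)) (x (k + 1) - x k) ≤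
        inner ℝ (gradient f (x (k + 1))) (x (k + 1) - x k)

/-- The Hessian `∇²f(x)`, as the derivative of the gradient map. -/
noncomputable def hessian {n : ℕ} (f : EuclideanSpace ℝ (Fin n) → ℝ)
    (x : EuclideanSpace ℝ (Fin n)) : EuclideanSpace ℝ (Fin n) →L[ℝ] EuclideanSpace ℝ (Fin n) :=
  fderiv ℝ (gradient f) x

/-- `f` is twice differentiable at every point of the (open) set `V`, and its Hessian is
continuous and positive definite throughout `V`. -/
def HasContinuousPosDefHessianOn {n : ℕ} (f : EuclideanSpace ℝ (Fin n) → ℝ)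
    (V : Set (EuclideanSpace ℝ (Fin n))) : Prop :=
  (∀ x ∈ V, DifferentiableAt ℝ f x ∧ DifferentiableAt ℝ (gradient f) x) ∧
  ContinuousOn (hessian f) V ∧
  ∀ x ∈ V, ∀ v : EuclideanSpace ℝ (Fin n), v ≠ 0 → 0 < inner ℝ v (hessian f x v)

section Matrix

open Matrix

section CommRing

variable {ι R : Type*} [Fintype ι] [CommRing R]

lemma dotProduct_mulVec_comm_of_isSymm {A : Matrix ι ι R} (hA : A.IsSymm) (u v : ι → R) :
    u ⬝ᵥ A *ᵥ v = v ⬝ᵥ A *ᵥ u := by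
  rw [dotProduct_mulVec, ← mulVec_transpose, hA.eq, dotProduct_comm]

variable [DecidableEq ι]

lemma det_one_add_vecMulVec (u v : ι → R) : (1 + vecMulVec u v).det = 1 + v ⬝ᵥ u := by
  rw [vecMulVec_eq Unit, det_one_add_replicateCol_mul_replicateRow]

lemma one_add_vecMulVec_mul_mul_transpose {A : Matrix ι ι R} (hA : A.IsSymm) (u v : ι → R) :
    (1 + vecMulVec u v) * A * (1 + vecMulVec u v)ᵀ =
      A + vecMulVec u (A *ᵥ v) + vecMulVec (A *ᵥ v) u + (v ⬝ᵥ A *ᵥ v) • vecMulVec u u := by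
  have hvA : v ᵥ* A = A *ᵥ v := by rw [← mulVec_transpose, hA.eq]
  simp only [transpose_add, transpose_one, transpose_vecMulVec, add_mul, one_mul, mul_add, mul_one,
    vecMulVec_mul, mul_vecMulVec, vecMulVec_mulVec, hvA, dotProduct_comm (A *ᵥ v) v,
    op_smul_eq_smul, smul_vecMulVec]
  abel

end CommRing

lemma inv_mulVec_eq_of_mulVec_eq_neg_smul {ι K : Type*} [Fintype ι] [DecidableEq ι]
    [Field K] {A : Matrix ι ι K} (hA : IsUnit A.det) {c : K} (hc : c ≠ 0) {u v : ι → K}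
    (huv : A *ᵥ u = -(c • v)) : A⁻¹ *ᵥ v = -c⁻¹ • u := by
  have hv : v = -c⁻¹ • A *ᵥ u := by rw [huv, neg_smul_neg, inv_smul_smul₀ hc]
  rw [hv, mulVec_smul, mulVec_mulVec, nonsing_inv_mul A hA, one_mulVec]

lemma real_inner_eq_dotProduct {ι : Type*} [Fintype ι] (u v : EuclideanSpace ℝ ι) :
    inner ℝ u v = u.ofLp ⬝ᵥ v.ofLp := by
  rw [EuclideanSpace.inner_eq_star_dotProduct, star_trivial, dotProduct_comm]

variable {n : ℕ} {H : Matrix (Fin n) (Fin n) ℝ} {s y g : EuclideanSpace ℝ (Fin n)}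

lemma dotProduct_inv_mulVec_pos (hH : H.PosDef) (hsy : 0 < inner ℝ s y) :
    0 < s.ofLp ⬝ᵥ H⁻¹ *ᵥ s.ofLp := by
  have hs : s.ofLp ≠ 0 := fun h => by simp [real_inner_eq_dotProduct, h] at hsy
  simpa using hH.inv.dotProduct_mulVec_pos hs

/- The product form of Brodlie, Gourlay and Greenstadt: unlike the defining formula, it exhibits the
update as a congruence, so that positive definiteness and the determinant can be read off. -/
lemma bfgsUpdate_eq_mul_mul_transpose (hH : H.IsSymm) (hdet : IsUnit H.det)
    (hsy : inner ℝ s y ≠ 0) {α : ℝ}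
    (hα : α ^ 2 * (s.ofLp ⬝ᵥ H⁻¹ *ᵥ s.ofLp) = (inner ℝ s y)⁻¹) :
    bfgsUpdate H s y =
      (1 + vecMulVec s.ofLp (α • H⁻¹ *ᵥ s.ofLp - (inner ℝ s y)⁻¹ • y.ofLp)) * H *
        (1 + vecMulVec s.ofLp (α • H⁻¹ *ᵥ s.ofLp - (inner ℝ s y)⁻¹ • y.ofLp))ᵀ := by
  have hHw : H *ᵥ H⁻¹ *ᵥ s.ofLp = s.ofLp := by
    rw [mulVec_mulVec, mul_nonsing_inv H hdet, one_mulVec]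
  have hwHy : H⁻¹ *ᵥ s.ofLp ⬝ᵥ H *ᵥ y.ofLp = inner ℝ s y := by
    rw [dotProduct_mulVec_comm_of_isSymm hH, hHw, dotProduct_comm, real_inner_eq_dotProduct]
  have hys : y.ofLp ⬝ᵥ s.ofLp = inner ℝ s y := by rw [dotProduct_comm, real_inner_eq_dotProduct]
  rw [bfgsUpdate, sub_eq_add_neg, ← neg_smul, ← vecMulVec_smul,
    one_add_vecMulVec_mul_mul_transpose hH, one_add_vecMulVec_mul_mul_transpose hH]
  simp only [mulVec_sub, mulVec_smul, hHw, dotProduct_sub, sub_dotProduct, dotProduct_smul,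
    smul_dotProduct, smul_eq_mul, hwHy, hys, dotProduct_comm (H⁻¹ *ᵥ s.ofLp) s.ofLp,
    vecMulVec_sub, sub_vecMulVec, vecMulVec_smul, smul_vecMulVec]
  have hρ : (inner ℝ s y)⁻¹ * inner ℝ s y = 1 := inv_mul_cancel₀ hsy
  match_scalars
  · ring
  · ring
  · ring
  · linear_combination -hα + 2 * α * hρ

lemma exists_bfgsUpdate_eq_mul_mul_transpose (hH : H.PosDef) (hsy : 0 < inner ℝ s y) :
    ∃ W : Matrix (Fin n) (Fin n) ℝ, bfgsUpdate H s y = W * H * Wᵀ ∧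
      W.det ^ 2 = (s.ofLp ⬝ᵥ H⁻¹ *ᵥ s.ofLp) / inner ℝ s y := by
  have hσ := dotProduct_inv_mulVec_pos hH hsy
  obtain ⟨α, hα⟩ : ∃ α : ℝ, α ^ 2 * (s.ofLp ⬝ᵥ H⁻¹ *ᵥ s.ofLp) = (inner ℝ s y)⁻¹ :=
    ⟨√((inner ℝ s y)⁻¹ / (s.ofLp ⬝ᵥ H⁻¹ *ᵥ s.ofLp)), by
      rw [Real.sq_sqrt (by positivity), div_mul_cancel₀ _ hσ.ne']⟩
  refine ⟨_, bfgsUpdate_eq_mul_mul_transpose (isHermitian_iff_isSymm.1 hH.isHermitian)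
    hH.det_pos.ne'.isUnit hsy.ne' hα, ?_⟩
  rw [det_one_add_vecMulVec, sub_dotProduct, smul_dotProduct, smul_dotProduct,
    dotProduct_comm _ s.ofLp, dotProduct_comm y.ofLp, ← real_inner_eq_dotProduct s y, smul_eq_mul,
    smul_eq_mul, inv_mul_cancel₀ hsy.ne', add_sub_cancel, mul_pow, div_eq_mul_inv, ← hα]
  ring

lemma bfgsUpdate_posDef (hH : H.PosDef) (hsy : 0 < inner ℝ s y) : (bfgsUpdate H s y).PosDef := by
  obtain ⟨W, hW, hdetW⟩ := exists_bfgsUpdate_eq_mul_mul_transpose hH hsy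
  have hWunit : IsUnit W := by
    rw [isUnit_iff_isUnit_det, isUnit_iff_ne_zero, ← pow_ne_zero_iff two_ne_zero, hdetW]
    exact (div_pos (dotProduct_inv_mulVec_pos hH hsy) hsy).ne'
  rw [hW, ← conjTranspose_eq_transpose_of_trivial, ← star_eq_conjTranspose]
  exact hWunit.posDef_star_right_conjugate_iff.2 hH

lemma det_bfgsUpdate (hH : H.PosDef) (hsy : 0 < inner ℝ s y) :
    (bfgsUpdate H s y).det = H.det * ((s.ofLp ⬝ᵥ H⁻¹ *ᵥ s.ofLp) / inner ℝ s y) := by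
  obtain ⟨W, hW, hdetW⟩ := exists_bfgsUpdate_eq_mul_mul_transpose hH hsy
  rw [hW, det_mul, det_mul, det_transpose, ← hdetW]
  ring

lemma inv_bfgsUpdate (hH : H.IsSymm) (hdet : IsUnit H.det) (hsy : inner ℝ s y ≠ 0)
    (hs : s.ofLp ⬝ᵥ H⁻¹ *ᵥ s.ofLp ≠ 0) :
    (bfgsUpdate H s y)⁻¹ =
      H⁻¹ - (s.ofLp ⬝ᵥ H⁻¹ *ᵥ s.ofLp)⁻¹ • vecMulVec (H⁻¹ *ᵥ s.ofLp) (H⁻¹ *ᵥ s.ofLp) +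
        (inner ℝ s y)⁻¹ • vecMulVec y.ofLp y.ofLp := by
  -- `B` annihilates `s` and `V` annihilates `s` and `yᵀ`, so only two terms of the product survive.
  apply inv_eq_left_inv
  set w := H⁻¹ *ᵥ s.ofLp with hw
  set V := 1 - (inner ℝ s y)⁻¹ • vecMulVec s.ofLp y.ofLp with hV
  set B := H⁻¹ - (s.ofLp ⬝ᵥ w)⁻¹ • vecMulVec w w with hB
  have hys : y.ofLp ⬝ᵥ s.ofLp = inner ℝ s y := by rw [dotProduct_comm, real_inner_eq_dotProduct]
  have hwH : w ᵥ* H = s.ofLp := by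
    rw [← mulVec_transpose, hH.eq, hw, mulVec_mulVec, mul_nonsing_inv H hdet, one_mulVec]
  have hVs : V *ᵥ s.ofLp = 0 := by
    simp [hV, sub_mulVec, smul_mulVec, vecMulVec_mulVec, hys, smul_smul, hsy]
  have hyV : y.ofLp ᵥ* V = 0 := by
    simp [hV, vecMul_sub, vecMul_smul, vecMul_vecMulVec, hys, smul_smul, hsy]
  have hBs : B *ᵥ s.ofLp = 0 := by
    simp [hB, sub_mulVec, smul_mulVec, vecMulVec_mulVec, dotProduct_comm w, smul_smul, hs, ← hw]
  have hBV : B * V = B := by simp [hV, mul_sub, mul_vecMulVec, hBs]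
  have hBHV : B * H * Vᵀ = Vᵀ := by
    rw [hB, sub_mul, nonsing_inv_mul H hdet, smul_mul_assoc, vecMulVec_mul, hwH, sub_mul, one_mul,
      smul_mul_assoc, vecMulVec_mul, vecMul_transpose, hVs, vecMulVec_zero, smul_zero, sub_zero]
  calc (B + (inner ℝ s y)⁻¹ • vecMulVec y.ofLp y.ofLp) * bfgsUpdate H s y
      = B * V * H * Vᵀ + (inner ℝ s y)⁻¹ • vecMulVec (B *ᵥ s.ofLp) s.ofLp +
          (inner ℝ s y)⁻¹ • (vecMulVec y.ofLp (y.ofLp ᵥ* V) * H * Vᵀ) +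
          (inner ℝ s y)⁻¹ • (inner ℝ s y)⁻¹ • (y.ofLp ⬝ᵥ s.ofLp) • vecMulVec y.ofLp s.ofLp := by
        rw [bfgsUpdate, ← hV]
        simp only [add_mul, mul_add, smul_add, mul_assoc, smul_mul_assoc, mul_smul_comm,
          ← mul_vecMulVec, ← vecMulVec_mul, vecMulVec_mul_vecMulVec, vecMulVec_smul]
        abel
    _ = Vᵀ + (inner ℝ s y)⁻¹ • vecMulVec y.ofLp s.ofLp := by
        rw [hBV, hBHV, hBs, hyV, hys, inv_smul_smul₀ hsy]
        simp
    _ = 1 := by simp [hV]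

/-- The Byrd–Nocedal potential `tr B - log det B`, which measures how far the positive definite
matrix `B` is from the identity. -/
noncomputable def byrdNocedalPotential {ι : Type*} [Fintype ι] [DecidableEq ι]
    (B : Matrix ι ι ℝ) : ℝ :=
  B.trace - Real.log B.det

lemma card_le_byrdNocedalPotential {ι : Type*} [Fintype ι] [DecidableEq ι] {B : Matrix ι ι ℝ}
    (hB : B.PosDef) : (Fintype.card ι : ℝ) ≤ byrdNocedalPotential B := by
  have hlog : ∀ i, 1 ≤ hB.isHermitian.eigenvalues i - Real.log (hB.isHermitian.eigenvalues i) :=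
    fun i => by linarith [Real.log_le_sub_one_of_pos (hB.eigenvalues_pos i)]
  calc (Fintype.card ι : ℝ) = ∑ _i : ι, (1 : ℝ) := by simp
    _ ≤ ∑ i, (hB.isHermitian.eigenvalues i - Real.log (hB.isHermitian.eigenvalues i)) :=
        Finset.sum_le_sum fun i _ => hlog i
    _ = byrdNocedalPotential B := by
        rw [Finset.sum_sub_distrib, ← Real.log_prod fun i _ => (hB.eigenvalues_pos i).ne',
          byrdNocedalPotential, hB.isHermitian.trace_eq_sum_eigenvalues,
          hB.isHermitian.det_eq_prod_eigenvalues]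
        rfl

lemma byrdNocedalPotential_inv_bfgsUpdate (hH : H.PosDef) (hsy : 0 < inner ℝ s y) :
    byrdNocedalPotential (bfgsUpdate H s y)⁻¹ =
      byrdNocedalPotential H⁻¹
        - (H⁻¹ *ᵥ s.ofLp ⬝ᵥ H⁻¹ *ᵥ s.ofLp) / (s.ofLp ⬝ᵥ H⁻¹ *ᵥ s.ofLp)
        + ‖y‖ ^ 2 / inner ℝ s y - Real.log (inner ℝ s y / (s.ofLp ⬝ᵥ H⁻¹ *ᵥ s.ofLp)) := by
  have hσ := dotProduct_inv_mulVec_pos hH hsy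
  have htrace : (bfgsUpdate H s y)⁻¹.trace =
      H⁻¹.trace - (H⁻¹ *ᵥ s.ofLp ⬝ᵥ H⁻¹ *ᵥ s.ofLp) / (s.ofLp ⬝ᵥ H⁻¹ *ᵥ s.ofLp)
        + ‖y‖ ^ 2 / inner ℝ s y := by
    rw [inv_bfgsUpdate (isHermitian_iff_isSymm.1 hH.isHermitian) hH.det_pos.ne'.isUnit hsy.ne'
      hσ.ne', trace_add, trace_sub, trace_smul, trace_smul, trace_vecMulVec, trace_vecMulVec,
      ← real_inner_eq_dotProduct y, real_inner_self_eq_norm_sq, smul_eq_mul, smul_eq_mul,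
      inv_mul_eq_div, inv_mul_eq_div]
  have hlogdet : Real.log (bfgsUpdate H s y)⁻¹.det =
      Real.log H⁻¹.det + Real.log (inner ℝ s y / (s.ofLp ⬝ᵥ H⁻¹ *ᵥ s.ofLp)) := by
    rw [det_nonsing_inv, det_nonsing_inv, det_bfgsUpdate hH hsy, Ring.inverse_eq_inv',
      mul_inv, inv_div, Real.log_mul (inv_ne_zero hH.det_pos.ne') (div_pos hsy hσ).ne']
  rw [byrdNocedalPotential, byrdNocedalPotential, htrace, hlogdet]
  ring

lemma byrdNocedalPotential_inv_bfgsUpdate_le (hH : H.PosDef) (hsy : 0 < inner ℝ s y) {c : ℝ}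
    (hg : H⁻¹ *ᵥ s.ofLp = c • g.ofLp) :
    byrdNocedalPotential (bfgsUpdate H s y)⁻¹ ≤
      byrdNocedalPotential H⁻¹ + ‖y‖ ^ 2 / inner ℝ s y - 1 -
        Real.log (‖g‖ ^ 2 * inner ℝ s y / inner ℝ g s ^ 2) := by
  have hσ : s.ofLp ⬝ᵥ H⁻¹ *ᵥ s.ofLp = c * inner ℝ g s := by
    rw [hg, dotProduct_smul, dotProduct_comm, ← real_inner_eq_dotProduct, smul_eq_mul]
  have hw : H⁻¹ *ᵥ s.ofLp ⬝ᵥ H⁻¹ *ᵥ s.ofLp = c ^ 2 * ‖g‖ ^ 2 := by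
    rw [hg, dotProduct_smul, smul_dotProduct, ← real_inner_eq_dotProduct,
      real_inner_self_eq_norm_sq, smul_eq_mul, smul_eq_mul]
    ring
  have hσ_pos : 0 < c * inner ℝ g s := hσ ▸ dotProduct_inv_mulVec_pos hH hsy
  have hc : c ≠ 0 := left_ne_zero_of_mul hσ_pos.ne'
  have hgs : inner ℝ g s ≠ 0 := right_ne_zero_of_mul hσ_pos.ne'
  have hg0 : g ≠ 0 := by rintro rfl; simp at hgs
  set t := c ^ 2 * ‖g‖ ^ 2 / (c * inner ℝ g s) with ht_def
  have ht : 0 < t := by positivity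
  have hlog : Real.log (‖g‖ ^ 2 * inner ℝ s y / inner ℝ g s ^ 2) =
      Real.log t + Real.log (inner ℝ s y / (c * inner ℝ g s)) := by
    rw [← Real.log_mul ht.ne' (by positivity), ht_def]
    congr 1
    field_simp
  -- `-t ≤ -1 - log t` makes the unknown scale `c` cancel.
  rw [byrdNocedalPotential_inv_bfgsUpdate hH hsy, hσ, hw, ← ht_def, hlog]
  linarith [Real.log_le_sub_one_of_pos ht]

lemma pos_and_inner_neg_of_mulVec_eq_neg_smul (hH : H.PosDef) (hg : g ≠ 0) {c : ℝ} (hc : 0 ≤ c)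
    (hHg : H *ᵥ g.ofLp = -(c • s.ofLp)) : 0 < c ∧ inner ℝ g s < 0 := by
  have hg' : g.ofLp ≠ 0 := by simpa using hg
  have hpos : 0 < g.ofLp ⬝ᵥ H *ᵥ g.ofLp := by simpa using hH.dotProduct_mulVec_pos hg'
  rw [hHg, dotProduct_neg, dotProduct_smul, ← real_inner_eq_dotProduct, smul_eq_mul,
    Left.neg_pos_iff] at hpos
  exact ⟨hc.lt_of_ne (by rintro rfl; simp at hpos), neg_of_mul_neg_right hpos hc⟩

end Matrix

section MonotoneOperator

/-- `G` is a monotone operator on `V` in the sense of Minty and Browder: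
`⟪b - a, G b - G a⟫ ≥ 0` for all `a, b ∈ V`. -/
def MonotoneOperatorOn {E : Type*} [NormedAddCommGroup E] [InnerProductSpace ℝ E]
    (G : E → E) (V : Set E) : Prop :=
  ∀ ⦃a⦄, a ∈ V → ∀ ⦃b⦄, b ∈ V → 0 ≤ inner ℝ (b - a) (G b - G a)

variable {E : Type*} [NormedAddCommGroup E] [InnerProductSpace ℝ E]

lemma add_inner_gradient_le_of_convexOn [CompleteSpace E] {U : Set E} {f : E → ℝ}
    (hf : ConvexOn ℝ U f) {a b : E} (ha : a ∈ U) (hb : b ∈ U) (hd : DifferentiableAt ℝ f a) :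
    f a + inner ℝ (gradient f a) (b - a) ≤ f b := by
  have hline : HasDerivAt (fun t : ℝ => AffineMap.lineMap a b t) (b - a) (0 : ℝ) :=
    AffineMap.hasDerivAt_lineMap
  have hfa : HasFDerivAt f (fderiv ℝ f a) (AffineMap.lineMap a b (0 : ℝ)) := by
    simpa using hd.hasFDerivAt
  have hslope := (hf.comp_affineMap (AffineMap.lineMap a b : ℝ →ᵃ[ℝ] E)).le_slope_of_hasDerivAt
    (x := 0) (y := 1) (by simpa using ha) (by simpa using hb) one_pos
    (hfa.comp_hasDerivAt (0 : ℝ) hline)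
  rw [slope_def_field, ← toDual_gradient, InnerProductSpace.toDual_apply_apply] at hslope
  simp only [Function.comp_apply, AffineMap.lineMap_apply_one, AffineMap.lineMap_apply_zero,
    sub_zero, div_one] at hslope
  linarith

lemma monotoneOperatorOn_gradient_of_convexOn [CompleteSpace E] {U V : Set E} {f : E → ℝ}
    (hf : ConvexOn ℝ U f) (hVU : V ⊆ U) (hd : ∀ a ∈ V, DifferentiableAt ℝ f a) :
    MonotoneOperatorOn (gradient f) V := by
  intro a ha b hb
  have hab := add_inner_gradient_le_of_convexOn hf (hVU ha) (hVU hb) (hd a ha)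
  have hba := add_inner_gradient_le_of_convexOn hf (hVU hb) (hVU ha) (hd b hb)
  rw [← neg_sub b a, inner_neg_right] at hba
  rw [real_inner_comm, inner_sub_left]
  linarith

variable [FiniteDimensional ℝ E] {G : E → E} {G' : E →L[ℝ] E} {a b : E} {V K : Set E}

lemma exists_pos_mul_norm_sq_le_inner_of_forall_pos (hG' : ∀ v, v ≠ 0 → 0 < inner ℝ v (G' v)) :
    ∃ m > 0, ∀ v, m * ‖v‖ ^ 2 ≤ inner ℝ v (G' v) := by
  rcases subsingleton_or_nontrivial E with hE | hE
  · exact ⟨1, one_pos, fun v => by simp [Subsingleton.elim v 0]⟩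
  obtain ⟨u, hu, hmin⟩ := (isCompact_sphere (0 : E) 1).exists_isMinOn
    (NormedSpace.sphere_nonempty.2 zero_le_one) (f := fun v => inner ℝ v (G' v)) (by fun_prop)
  have hu0 : u ≠ 0 := by rintro rfl; simp at hu
  refine ⟨inner ℝ u (G' u), hG' u hu0, fun v => ?_⟩
  rcases eq_or_ne v 0 with rfl | hv
  · simp
  have hle : inner ℝ u (G' u) ≤ inner ℝ (‖v‖⁻¹ • v) (G' (‖v‖⁻¹ • v)) :=
    hmin (by simp [norm_smul, hv])
  calc inner ℝ u (G' u) * ‖v‖ ^ 2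
      ≤ inner ℝ (‖v‖⁻¹ • v) (G' (‖v‖⁻¹ • v)) * ‖v‖ ^ 2 := by gcongr
    _ = inner ℝ v (G' v) := by
        rw [map_smul, inner_smul_left, inner_smul_right, conj_trivial]
        field_simp

lemma exists_pos_eventually_mul_norm_sq_le_inner (hG : HasStrictFDerivAt G G' a)
    (hG' : ∀ v, v ≠ 0 → 0 < inner ℝ v (G' v)) :
    ∃ m > 0, ∀ᶠ p in 𝓝 (a, a), m * ‖p.1 - p.2‖ ^ 2 ≤ inner ℝ (p.1 - p.2) (G p.1 - G p.2) := by
  obtain ⟨m, hm, hcoercive⟩ := exists_pos_mul_norm_sq_le_inner_of_forall_pos hG'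
  refine ⟨m / 2, half_pos hm, ?_⟩
  filter_upwards [hG.isLittleO.def (half_pos hm)] with p hp
  have herror : -(m / 2 * ‖p.1 - p.2‖ ^ 2) ≤
      inner ℝ (p.1 - p.2) (G p.1 - G p.2 - G' (p.1 - p.2)) := by
    refine (abs_le.1 ((abs_real_inner_le_norm _ _).trans ?_)).1
    calc ‖p.1 - p.2‖ * ‖G p.1 - G p.2 - G' (p.1 - p.2)‖
        ≤ ‖p.1 - p.2‖ * (m / 2 * ‖p.1 - p.2‖) := by gcongr
      _ = m / 2 * ‖p.1 - p.2‖ ^ 2 := by ring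
  rw [inner_sub_right] at herror
  linarith [hcoercive (p.1 - p.2)]

lemma inner_sub_pos_of_monotoneOperatorOn (hmono : MonotoneOperatorOn G V) (hV : IsOpen V)
    (ha : a ∈ V) (hb : b ∈ V) (hab : a ≠ b) (hG : HasStrictFDerivAt G G' a)
    (hG' : ∀ v, v ≠ 0 → 0 < inner ℝ v (G' v)) : 0 < inner ℝ (b - a) (G b - G a) := by
  -- The segment from `a` to `b` may leave `V`: strong monotonicity is used between `a` and a
  -- nearby `p` on the segment, plain monotonicity between `p` and `b`.
  obtain ⟨m, hm, hstrong⟩ := exists_pos_eventually_mul_norm_sq_le_inner hG hG'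
  have hline : Tendsto (AffineMap.lineMap a b : ℝ → E) (𝓝[>] 0) (𝓝 a) :=
    (AffineMap.lineMap_continuous.tendsto' 0 a (AffineMap.lineMap_apply_zero a b)).mono_left
      nhdsWithin_le_nhds
  obtain ⟨t, ⟨hpa, hpV⟩, ht0, ht1⟩ :=
    (((hline.prodMk_nhds tendsto_const_nhds).eventually hstrong).and
      (hline.eventually (hV.mem_nhds ha)) |>.and (Ioo_mem_nhdsGT one_pos)).exists
  set p : E := AffineMap.lineMap a b t with hp
  have hp_sub : p - a = t • (b - a) := by rw [hp, AffineMap.lineMap_apply_module']; abel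
  have hsub_p : b - p = (1 - t) • (b - a) := by
    rw [hp, AffineMap.lineMap_apply_module', sub_smul, one_smul]; abel
  have hnear : 0 < inner ℝ (b - a) (G p - G a) := by
    have hpos : 0 < m * ‖p - a‖ ^ 2 := by
      have hba : b - a ≠ 0 := sub_ne_zero.2 hab.symm
      rw [hp_sub, norm_smul, Real.norm_of_nonneg ht0.le]
      positivity
    have := hpos.trans_le hpa
    simp only [hp_sub, real_inner_smul_left] at this
    exact pos_of_mul_pos_right this ht0.le
  have hfar : 0 ≤ inner ℝ (b - a) (G b - G p) := by
    have := hmono hpV hb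
    rw [hsub_p, real_inner_smul_left] at this
    exact nonneg_of_mul_nonneg_right this (sub_pos.2 ht1)
  rw [← sub_add_sub_cancel (G b) (G p), inner_add_right]
  linarith

lemma isBigO_principal_of_isCompact {X F₁ F₂ : Type*} [TopologicalSpace X]
    [Norm F₁] [SeminormedAddCommGroup F₂] {K : Set X} (hK : IsCompact K)
    {φ : X → F₁} {ψ : X → F₂} (hφψ : ∀ p ∈ K, φ =O[𝓝[K] p] ψ) : φ =O[𝓟 K] ψ := by
  refine hK.induction_on (p := fun S => φ =O[𝓟 S] ψ) (by simp) ?_ ?_ ?_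
  · exact fun S T hST hT => hT.mono (principal_mono.2 hST)
  · exact fun S T hS hT => sup_principal (s := S) (t := T) ▸ hS.sup hT
  · intro p hp
    obtain ⟨c, hc⟩ := Asymptotics.isBigO_iff.1 (hφψ p hp)
    exact ⟨_, hc, Asymptotics.isBigO_principal.2 ⟨c, fun _ hx => hx⟩⟩

lemma exists_norm_sub_sq_le_mul_inner_of_isCompact (hmono : MonotoneOperatorOn G V)
    (hV : IsOpen V) {G' : E → E →L[ℝ] E} (hG : ∀ a ∈ V, HasStrictFDerivAt G (G' a) a)
    (hG' : ∀ a ∈ V, ∀ v, v ≠ 0 → 0 < inner ℝ v (G' a v)) (hK : IsCompact K) (hKV : K ⊆ V) :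
    ∃ M, ∀ a ∈ K, ∀ b ∈ K, ‖G b - G a‖ ^ 2 ≤ M * inner ℝ (b - a) (G b - G a) := by
  have hlocal : ∀ p ∈ K ×ˢ K, (fun p : E × E => ‖G p.1 - G p.2‖ ^ 2)
      =O[𝓝 p] fun p => inner ℝ (p.1 - p.2) (G p.1 - G p.2) := by
    rintro ⟨a, b⟩ ⟨ha, hb⟩
    rcases eq_or_ne a b with rfl | hab
    · obtain ⟨m, hm, hstrong⟩ :=
        exists_pos_eventually_mul_norm_sq_le_inner (hG a (hKV ha)) (hG' a (hKV ha))
      have hsq : (fun p : E × E => ‖G p.1 - G p.2‖ ^ 2) =O[𝓝 (a, a)] fun p => ‖p.1 - p.2‖ ^ 2 :=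
        ((hG a (hKV ha)).isBigO_sub.norm_norm).pow 2
      refine hsq.trans (.of_bound m⁻¹ ?_)
      filter_upwards [hstrong] with p hp
      rw [Real.norm_of_nonneg (by positivity), inv_mul_eq_div, le_div_iff₀' hm]
      exact hp.trans (le_abs_self _)
    · have hGa : Tendsto (fun p : E × E => G p.1) (𝓝 (a, b)) (𝓝 (G a)) :=
        (hG a (hKV ha)).continuousAt.tendsto.comp continuousAt_fst
      have hGb : Tendsto (fun p : E × E => G p.2) (𝓝 (a, b)) (𝓝 (G b)) :=
        (hG b (hKV hb)).continuousAt.tendsto.comp continuousAt_snd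
      have hnum := (hGa.sub hGb).norm.pow 2
      have hden := (continuousAt_fst.sub continuousAt_snd).tendsto.inner (𝕜 := ℝ) (hGa.sub hGb)
      have hpos := inner_sub_pos_of_monotoneOperatorOn hmono hV (hKV hb) (hKV ha) hab.symm
        (hG b (hKV hb)) (hG' b (hKV hb))
      exact (Asymptotics.isBigO_const_of_tendsto hnum hpos.ne').trans
        ((Asymptotics.isEquivalent_const_iff_tendsto hpos.ne').2 hden).isBigO_symm
  obtain ⟨M, hM⟩ := Asymptotics.isBigO_principal.1 <|
    isBigO_principal_of_isCompact (hK.prod hK) fun p hp => (hlocal p hp).mono nhdsWithin_le_nhds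
  refine ⟨M, fun a ha b hb => ?_⟩
  simpa [abs_of_nonneg (hmono (hKV ha) (hKV hb))] using hM (b, a) ⟨hb, ha⟩

end MonotoneOperator

lemma HasContinuousPosDefHessianOn.hasStrictFDerivAt {n : ℕ} {f : EuclideanSpace ℝ (Fin n) → ℝ}
    {V : Set (EuclideanSpace ℝ (Fin n))} (h : HasContinuousPosDefHessianOn f V) (hV : IsOpen V)
    {a : EuclideanSpace ℝ (Fin n)} (ha : a ∈ V) :
    HasStrictFDerivAt (gradient f) (hessian f a) a := by
  refine hasStrictFDerivAt_of_hasFDerivAt_of_continuousAt (𝕜 := ℝ) ?_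
    (h.2.1.continuousAt (hV.mem_nhds ha))
  filter_upwards [hV.mem_nhds ha] with z hz using (h.1 z hz).2.hasFDerivAt

lemma exists_isMinOn_of_isCompact_sublevel {X α : Type*} [TopologicalSpace X]
    [TopologicalSpace α] [LinearOrder α] [ClosedIicTopology α] {U : Set X} {f : X → α} {x₀ : X}
    (hf : ContinuousOn f U) (hx₀ : x₀ ∈ U) (hK : IsCompact {z ∈ U | f z ≤ f x₀}) :
    ∃ z ∈ U, IsMinOn f U z := by
  obtain ⟨z, ⟨hzU, hz₀⟩, hmin⟩ := hK.exists_isMinOn ⟨x₀, hx₀, le_rfl⟩ (hf.mono fun _ hw => hw.1)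
  refine ⟨z, hzU, fun w hw => ?_⟩
  rcases le_total (f w) (f x₀) with hw₀ | hw₀
  · exact hmin ⟨hw, hw₀⟩
  · exact hz₀.trans hw₀

lemma not_tendsto_atTop_of_add_le {ψ r : ℕ → ℝ} (hψ : BddBelow (Set.range ψ))
    (hr : ∀ k, ψ (k + 1) + r k ≤ ψ k) : ¬ Tendsto r atTop atTop := by
  intro hlim
  obtain ⟨b, hb⟩ := hψ
  obtain ⟨N, hN⟩ := eventually_atTop.1 (hlim.eventually_ge_atTop 1)
  have hdecr : ∀ j : ℕ, ψ (N + j) ≤ ψ N - j := by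
    intro j
    induction j with
    | zero => simp
    | succ j ih =>
      have hstep := hr (N + j)
      have hone := hN (N + j) (Nat.le_add_right N j)
      push_cast
      rw [← add_assoc]
      linarith
  obtain ⟨j, hj⟩ := exists_nat_gt (ψ N - b)
  linarith [hdecr j, hb (Set.mem_range_self (N + j))]

/-- A run of the BFGS method: the sequence `x` together with its Wolfe parameters `μ`, `ν` and its
inverse Hessian approximations `H k`. The search direction is recorded through `(H k)⁻¹`, and the
curvature condition through the gradient difference, as these are the forms in which the
Byrd–Nocedal potential involves them. -/
structure BFGSRun {n : ℕ} (f : EuclideanSpace ℝ (Fin n) → ℝ) (x : ℕ → EuclideanSpace ℝ (Fin n))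
    (μ ν : ℝ) (H : ℕ → Matrix (Fin n) (Fin n) ℝ) : Prop where
  μ_pos : 0 < μ
  ν_lt_one : ν < 1
  posDef : ∀ k, (H k).PosDef
  update : ∀ k, H (k + 1) =
    bfgsUpdate (H k) (x (k + 1) - x k) (gradient f (x (k + 1)) - gradient f (x k))
  direction : ∀ k, ∃ c : ℝ,
    (H k)⁻¹.mulVec (x (k + 1) - x k).ofLp = c • (gradient f (x k)).ofLp
  descent : ∀ k, inner ℝ (gradient f (x k)) (x (k + 1) - x k) < 0
  armijo : ∀ k, f (x (k + 1)) ≤ f (x k) + μ * inner ℝ (gradient f (x k)) (x (k + 1) - x k)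
  curvature : ∀ k, (1 - ν) * -inner ℝ (gradient f (x k)) (x (k + 1) - x k) ≤
    inner ℝ (x (k + 1) - x k) (gradient f (x (k + 1)) - gradient f (x k))

section BFGS

variable {n : ℕ} {f : EuclideanSpace ℝ (Fin n) → ℝ} {x : ℕ → EuclideanSpace ℝ (Fin n)}

lemma IsBFGSSequence.exists_run (hx : IsBFGSSequence f x) : ∃ μ ν H, BFGSRun f x μ ν H := by
  obtain ⟨hdiff, μ, ν, H₀, hμ, -, hν, hH₀, hstep⟩ := hx
  have hcurv : ∀ k, (1 - ν) * -inner ℝ (gradient f (x k)) (x (k + 1) - x k) ≤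
      inner ℝ (x (k + 1) - x k) (gradient f (x (k + 1)) - gradient f (x k)) := fun k => by
    rw [real_inner_comm (gradient f (x (k + 1)) - _), inner_sub_left]
    linarith [(hstep k).2.2]
  have hdir : ∀ k, (bfgsMatrix f x H₀ k).PosDef → ∃ c : ℝ, 0 < c ∧
      (bfgsMatrix f x H₀ k).mulVec (gradient f (x k)).ofLp = -(c • (x (k + 1) - x k).ofLp) ∧
      inner ℝ (gradient f (x k)) (x (k + 1) - x k) < 0 := fun k hH => by
    obtain ⟨⟨c, hc, hHg⟩, -⟩ := hstep k
    obtain ⟨hc', hgs⟩ := pos_and_inner_neg_of_mulVec_eq_neg_smul hH (hdiff k).2 hc hHg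
    exact ⟨c, hc', hHg, hgs⟩
  have hpos : ∀ k, (bfgsMatrix f x H₀ k).PosDef := by
    intro k
    induction k with
    | zero => exact hH₀
    | succ k ih =>
      obtain ⟨-, -, -, hgs⟩ := hdir k ih
      exact bfgsUpdate_posDef ih <|
        (mul_pos (sub_pos.2 hν) (neg_pos.2 hgs)).trans_le (hcurv k)
  refine ⟨μ, ν, bfgsMatrix f x H₀, hμ, hν, hpos, fun k => rfl, fun k => ?_, fun k => ?_,
    fun k => (hstep k).2.1, hcurv⟩
  · obtain ⟨c, hc, hHg, -⟩ := hdir k (hpos k)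
    exact ⟨-c⁻¹, inv_mulVec_eq_of_mulVec_eq_neg_smul (hpos k).det_pos.ne'.isUnit hc.ne' hHg⟩
  · obtain ⟨-, -, -, hgs⟩ := hdir k (hpos k)
    exact hgs

namespace BFGSRun

variable {μ ν : ℝ} {H : ℕ → Matrix (Fin n) (Fin n) ℝ}

lemma inner_sub_gradient_sub_pos (h : BFGSRun f x μ ν H) (k : ℕ) :
    0 < inner ℝ (x (k + 1) - x k) (gradient f (x (k + 1)) - gradient f (x k)) :=
  (mul_pos (sub_pos.2 h.ν_lt_one) (neg_pos.2 (h.descent k))).trans_le (h.curvature k)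

lemma antitone (h : BFGSRun f x μ ν H) : Antitone fun k => f (x k) :=
  antitone_nat_of_succ_le fun k => by
    linarith [h.armijo k, mul_neg_of_pos_of_neg h.μ_pos (h.descent k)]

lemma tendsto_neg_inner_gradient_nhdsGT_zero (h : BFGSRun f x μ ν H)
    (hf : BddBelow (Set.range fun k => f (x k))) :
    Tendsto (fun k => -inner ℝ (gradient f (x k)) (x (k + 1) - x k)) atTop (𝓝[>] 0) := by
  have hlim := tendsto_atTop_ciInf h.antitone hf
  have hdecr : Tendsto (fun k => (f (x k) - f (x (k + 1))) / μ) atTop (𝓝 0) := by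
    simpa using (hlim.sub (hlim.comp (tendsto_add_atTop_nat 1))).div_const μ
  refine tendsto_nhdsWithin_iff.2 ⟨squeeze_zero (fun k => (neg_pos.2 (h.descent k)).le)
    (fun k => ?_) hdecr, .of_forall fun k => neg_pos.2 (h.descent k)⟩
  rw [le_div_iff₀ h.μ_pos]
  linarith [h.armijo k]

lemma tendsto_log_norm_sq_mul_inner_div_atTop (h : BFGSRun f x μ ν H)
    (hf : BddBelow (Set.range fun k => f (x k))) {ε : ℝ} (hε : 0 < ε)
    (hgrad : ∀ k, ε ≤ ‖gradient f (x k)‖) :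
    Tendsto (fun k => Real.log (‖gradient f (x k)‖ ^ 2 *
      inner ℝ (x (k + 1) - x k) (gradient f (x (k + 1)) - gradient f (x k)) /
        inner ℝ (gradient f (x k)) (x (k + 1) - x k) ^ 2)) atTop atTop := by
  refine Real.tendsto_log_atTop.comp (tendsto_atTop_mono (fun k => ?_)
    ((h.tendsto_neg_inner_gradient_nhdsGT_zero hf).inv_tendsto_nhdsGT_zero.const_mul_atTop
      (mul_pos (pow_pos hε 2) (sub_pos.2 h.ν_lt_one))))
  have hgs := neg_pos.2 (h.descent k)
  have hν := sub_pos.2 h.ν_lt_one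
  set d := -inner ℝ (gradient f (x k)) (x (k + 1) - x k) with hd
  calc ε ^ 2 * (1 - ν) * d⁻¹ = ε ^ 2 * ((1 - ν) * d) / d ^ 2 := by field_simp
    _ ≤ _ := by
      rw [← neg_sq (inner ℝ (gradient f (x k)) _), ← hd]
      gcongr
      exacts [hgrad k, h.curvature k]

theorem exists_norm_gradient_lt (h : BFGSRun f x μ ν H)
    (hf : BddBelow (Set.range fun k => f (x k))) {M : ℝ}
    (hM : ∀ k, ‖gradient f (x (k + 1)) - gradient f (x k)‖ ^ 2 ≤
      M * inner ℝ (x (k + 1) - x k) (gradient f (x (k + 1)) - gradient f (x k)))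
    {ε : ℝ} (hε : 0 < ε) : ∃ k, ‖gradient f (x k)‖ < ε := by
  by_contra! hgrad
  have hψ : BddBelow (Set.range fun k => byrdNocedalPotential (H k)⁻¹) :=
    ⟨_, Set.forall_mem_range.2 fun k => card_le_byrdNocedalPotential (h.posDef k).inv⟩
  have hlog := h.tendsto_log_norm_sq_mul_inner_div_atTop hf hε hgrad
  refine not_tendsto_atTop_of_add_le hψ (fun k => ?_)
    (tendsto_atTop_add_const_right atTop (1 - M) hlog)
  obtain ⟨c, hdir⟩ := h.direction k
  have hsy := h.inner_sub_gradient_sub_pos k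
  have hstep := byrdNocedalPotential_inv_bfgsUpdate_le (h.posDef k) hsy hdir
  rw [← h.update k] at hstep
  linarith [(div_le_iff₀ hsy).2 (hM k)]

theorem ciInf_le_of_convexOn (h : BFGSRun f x μ ν H) {U : Set (EuclideanSpace ℝ (Fin n))}
    (hf : ConvexOn ℝ U f) (hxU : ∀ k, x k ∈ U) (hdiff : ∀ k, DifferentiableAt ℝ f (x k))
    (hbdd : BddBelow (Set.range fun k => f (x k))) (hx : Bornology.IsBounded (Set.range x))
    {M : ℝ} (hM : ∀ k, ‖gradient f (x (k + 1)) - gradient f (x k)‖ ^ 2 ≤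
      M * inner ℝ (x (k + 1) - x k) (gradient f (x (k + 1)) - gradient f (x k)))
    {z : EuclideanSpace ℝ (Fin n)} (hz : z ∈ U) : ⨅ k, f (x k) ≤ f z := by
  obtain ⟨R, hR, hball⟩ := hx.subset_closedBall_lt 0 z
  have hxR : ∀ k, ‖z - x k‖ ≤ R := fun k => by
    simpa [dist_eq_norm_sub'] using hball (Set.mem_range_self k)
  refine le_of_forall_pos_le_add fun ε hε => ?_
  obtain ⟨k, hk⟩ := h.exists_norm_gradient_lt hbdd hM (div_pos hε hR)
  have hinner : -ε ≤ inner ℝ (gradient f (x k)) (z - x k) := by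
    refine (abs_le.1 ((abs_real_inner_le_norm _ _).trans ?_)).1
    calc ‖gradient f (x k)‖ * ‖z - x k‖ ≤ ε / R * R := by gcongr; exact hxR k
      _ = ε := div_mul_cancel₀ ε hR.ne'
  linarith [ciInf_le hbdd k, add_inner_gradient_le_of_convexOn hf (hxU k) hz (hdiff k)]

theorem ciInf_eq_of_isMinOn (h : BFGSRun f x μ ν H) {U : Set (EuclideanSpace ℝ (Fin n))}
    (hU : IsOpen U) (hf : ConvexOn ℝ U f) (hxU : ∀ k, x k ∈ U)
    (hlevel : IsCompact {w ∈ U | f w ≤ f (x 0)}) {z : EuclideanSpace ℝ (Fin n)} (hzU : z ∈ U)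
    (hz : IsMinOn f U z) (hsmooth : HasContinuousPosDefHessianOn f {w ∈ U | f z < f w}) :
    ⨅ k, f (x k) = f z := by
  set c := ⨅ k, f (x k)
  refine le_antisymm (not_lt.1 fun hlt => ?_) (le_ciInf fun k => hz (hxU k))
  have hcont : ContinuousOn f U := hf.continuousOn hU
  have hbdd : BddBelow (Set.range fun k => f (x k)) :=
    ⟨f z, Set.forall_mem_range.2 fun k => hz (hxU k)⟩
  set K := {w ∈ U | f w ≤ f (x 0)} ∩ f ⁻¹' Set.Ici c
  set V := {w ∈ U | f z < f w}
  have hK : IsCompact K := hlevel.of_isClosed_subset ((hcont.mono fun _ hw => hw.1)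
    |>.preimage_isClosed_of_isClosed hlevel.isClosed isClosed_Ici) Set.inter_subset_left
  have hV : IsOpen V := hcont.isOpen_inter_preimage hU isOpen_Ioi
  have hKV : K ⊆ V := fun w hw => ⟨hw.1.1, hlt.trans_le hw.2⟩
  have hxK : ∀ k, x k ∈ K := fun k =>
    ⟨⟨hxU k, h.antitone (Nat.zero_le k)⟩, ciInf_le hbdd k⟩
  have hmono : MonotoneOperatorOn (gradient f) V :=
    monotoneOperatorOn_gradient_of_convexOn hf (fun _ hw => hw.1) fun w hw => (hsmooth.1 w hw).1
  obtain ⟨M, hM⟩ := exists_norm_sub_sq_le_mul_inner_of_isCompact hmono hV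
    (fun _ hw => hsmooth.hasStrictFDerivAt hV hw) hsmooth.2.2 hK hKV
  exact hlt.not_ge <| h.ciInf_le_of_convexOn hf hxU (fun k => (hsmooth.1 _ (hKV (hxK k))).1) hbdd
    (hK.isBounded.subset (Set.range_subset_iff.2 hxK))
    (fun k => hM _ (hxK k) _ (hxK (k + 1))) hzU

end BFGSRun

end BFGS

theorem mainTheorem5 {n : ℕ} (U : Set (EuclideanSpace ℝ (Fin n)))
    (hUopen : IsOpen U) (hUconv : Convex ℝ U)
    (f : EuclideanSpace ℝ (Fin n) → ℝ) (hf : ConvexOn ℝ U f)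
    (x : ℕ → EuclideanSpace ℝ (Fin n)) (hxU : ∀ k, x k ∈ U)
    (hx : IsBFGSSequence f x)
    (hlevel : IsCompact {z ∈ U | f z ≤ f (x 0)})
    (hsmooth : HasContinuousPosDefHessianOn f {z ∈ U | sInf (f '' U) < f z}) :
    IsLeast (f '' U) (sInf (f '' U)) ∧
      Tendsto (fun k => f (x k)) atTop (𝓝 (sInf (f '' U))) := by
  obtain ⟨z, hzU, hz⟩ :=
    exists_isMinOn_of_isCompact_sublevel (hf.continuousOn hUopen) (hxU 0) hlevel
  have hleast : IsLeast (f '' U) (f z) :=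
    ⟨Set.mem_image_of_mem f hzU, Set.forall_mem_image.2 fun _ hw => hz hw⟩
  have hbdd : BddBelow (Set.range fun k => f (x k)) :=
    ⟨f z, Set.forall_mem_range.2 fun k => hz (hxU k)⟩
  rw [hleast.csInf_eq] at hsmooth ⊢
  obtain ⟨μ, ν, H, hrun⟩ := hx.exists_run
  refine ⟨hleast, ?_⟩
  rw [← hrun.ciInf_eq_of_isMinOn hUopen hf hxU hlevel hzU hz hsmooth]
  exact tendsto_atTop_ciInf hrun.antitone hbdd
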